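/- Let $m\ge 1$, let $U\subset\mathbb R^m$ be open and let $a\le 0\le b$ be real numbers. Let $\mathcal M(U)$ be the space of finite signed Radon measures on $U$, let $$\mathcal{DM}_\infty(U)=\{u\in L_\infty(U;\mathbb R^m): \operatorname{div}u\in\mathcal M(U)\}$$ with $\operatorname{div}$ the distributional divergence, and let $\mathcal{DB}(U)$ be the closure of $\mathcal{DM}_\infty(U)$ in $L_\infty(U;\mathbb R^m)$, with dual space $\mathcal{DB}'(U)$. Let $\bar{\mathcal S}(U)$ be the completion, with respect to the Hausdorff measure $\mathcal H^{m-1}$ on $U$, of the $\sigma$-algebra generated by the Suslin subsets of $U$. A bounded, $\bar{\mathcal S}(U)$-measurable function $f\colon U\to\mathbb R$ has bounded fluctuation if $$\|f\|_{BF(U)}=\sup\Big\{\int_U f\,\mathrm d\operatorname{div}u : u\in\mathcal{DM}_\infty(U),\ \|u\|_\infty\le 1\Big\}<\infty ,$$ and then $\mu_f\in\mathcal{DB}'(U)$ denotes the unique continuous linear functional with $\langle\mu_f,u\rangle=-\int_U f\,\mathrm d\operatorname{div}u$ for all $u\in\mathcal{DM}_\infty(U)$. Suppose that $f\colon U\to[a,b]$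 has bounded fluctuation and is continuous on $U$. Then there is a sequence of smooth functions $f_n\colon U\to[a,b]$ with compact support in $U$ such that $\sup_n\|\nabla f_n\|_{L_1(U)}\le\|f\|_{BF(U)}$, the $f_n$ converge to $f$ uniformly on every compact subset of $U$, and $\nabla f_n$ converges to $\mu_f$ weakly* in $\mathcal{DB}'(U)$, that is, $\int_U\nabla f_n\cdot u\,\mathrm dx\to\langle\mu_f,u\rangle$ for every $u\in\mathcal{DB}(U)$. -/

import Mathlib

open MeasureTheory Filter Topology TopologicalSpace
open scoped ENNReal NNReal Distributions

namespace BoundedFluctuation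

/-- The space `L_∞(U; ℝᵐ)` of essentially bounded vector fields on the open set `U ⊆ ℝᵐ`, with the
essential supremum of the Euclidean norm as its norm. -/
abbrev LInf {m : ℕ} (U : Opens (EuclideanSpace ℝ (Fin m))) : Type :=
  Lp (EuclideanSpace ℝ (Fin m)) ∞
    ((volume : Measure (EuclideanSpace ℝ (Fin m))).restrict (U : Set (EuclideanSpace ℝ (Fin m))))

/-- The integral `∫_U f dμ` of a real function on `U` against a finite signed Borel measure on `U`.
(Every finite signed Borel measure on an open subset of `ℝᵐ` is Radon, so `SignedMeasure U` is the
space `M(U)` of finite signed Radon measures.) -/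
noncomputable def sIntegral {m : ℕ} {U : Opens (EuclideanSpace ℝ (Fin m))} (f : U → ℝ)
    (μ : SignedMeasure U) : ℝ :=
  VectorMeasure.integral μ f (ContinuousLinearMap.lsmul ℝ ℝ).flip

/-- The pairing `∫_U ∇φ · u dx` of the gradient of a test function `φ ∈ C_{∞,c}(U)` with a bounded
vector field `u`. -/
noncomputable def gradPairing {m : ℕ} {U : Opens (EuclideanSpace ℝ (Fin m))} (φ : 𝓓(U, ℝ))
    (u : LInf U) : ℝ :=
  ∫ x in (U : Set (EuclideanSpace ℝ (Fin m))), inner ℝ (gradient φ x) (u x)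

/-- The finite signed measure `μ` on `U` is the distributional divergence of `u`:
`∫_U ∇φ · u dx = - ∫_U φ dμ` for all `φ ∈ C_{∞,c}(U)`. -/
def IsDivergence {m : ℕ} {U : Opens (EuclideanSpace ℝ (Fin m))} (u : LInf U)
    (μ : SignedMeasure U) : Prop :=
  ∀ φ : 𝓓(U, ℝ), gradPairing φ u = - sIntegral (fun x : U => φ x) μ

section Facts

variable {m : ℕ} {U : Opens (EuclideanSpace ℝ (Fin m))}

theorem integrable_of_bdd (μ : SignedMeasure U) {f : U → ℝ} (hf : Continuous f)
    (hb : ∃ C : ℝ, ∀ x, |f x| ≤ C) : VectorMeasure.Integrable μ f := by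
  obtain ⟨C, hC⟩ := hb
  have : IsFiniteMeasure (VectorMeasure.variation μ) := by
    rw [← SignedMeasure.totalVariation_eq_variation]; infer_instance
  exact Integrable.of_bound hf.aestronglyMeasurable C (Eventually.of_forall hC)

theorem continuous_test (φ : 𝓓(U, ℝ)) : Continuous (fun x : U => φ x) :=
  φ.continuous.comp continuous_subtype_val

theorem bdd_test (φ : 𝓓(U, ℝ)) : ∃ C : ℝ, ∀ x : U, |φ x| ≤ C := by
  obtain ⟨C, hC⟩ := φ.continuous.bounded_above_of_compact_support φ.hasCompactSupport
  exact ⟨C, fun x => hC x⟩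

theorem sIntegral_add {f : U → ℝ} (hf : Continuous f) (hb : ∃ C : ℝ, ∀ x, |f x| ≤ C)
    (μ ν : SignedMeasure U) : sIntegral f (μ + ν) = sIntegral f μ + sIntegral f ν :=
  VectorMeasure.integral_add_vectorMeasure (integrable_of_bdd μ hf hb) (integrable_of_bdd ν hf hb)

theorem sIntegral_smul (f : U → ℝ) (c : ℝ) (μ : SignedMeasure U) :
    sIntegral f (c • μ) = c * sIntegral f μ :=
  VectorMeasure.integral_smul_vectorMeasure f c

/-- The integral against a signed measure is the difference of the integrals against the two
parts of its Jordan decomposition. -/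
theorem sIntegral_eq (μ : SignedMeasure U) {f : U → ℝ} (hf : Continuous f)
    (hb : ∃ C : ℝ, ∀ x, |f x| ≤ C) :
    sIntegral f μ = ∫ x, f x ∂ μ.toJordanDecomposition.posPart
      - ∫ x, f x ∂ μ.toJordanDecomposition.negPart := by
  conv_lhs => rw [← μ.toSignedMeasure_toJordanDecomposition]
  rw [JordanDecomposition.toSignedMeasure, sIntegral, VectorMeasure.integral_sub_vectorMeasure,
    VectorMeasure.integral_toSignedMeasure, VectorMeasure.integral_toSignedMeasure] <;>
  exact integrable_of_bdd _ hf hb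

theorem measure_ext (P N : Measure U) [IsFiniteMeasure P] [IsFiniteMeasure N]
    (h : ∀ φ : 𝓓(U, ℝ), ∫ x : U, φ x ∂P = ∫ x : U, φ x ∂N) : P = N := by
  have emb : MeasurableEmbedding (Subtype.val : U → EuclideanSpace ℝ (Fin m)) :=
    MeasurableEmbedding.subtype_coe U.isOpen.measurableSet
  set P' := P.map (Subtype.val : U → EuclideanSpace ℝ (Fin m)) with hP'
  set N' := N.map (Subtype.val : U → EuclideanSpace ℝ (Fin m)) with hN'
  have hPac : P' ≪ P' + N' := Measure.AbsolutelyContinuous.rfl.add_right _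
  have hNac : N' ≪ P' + N' := by rw [add_comm]; exact Measure.AbsolutelyContinuous.rfl.add_right _
  have iP := Measure.integrable_toReal_rnDeriv (μ := P') (ν := P' + N')
  have iN := Measure.integrable_toReal_rnDeriv (μ := N') (ν := P' + N')
  have key := U.isOpen.ae_eq_zero_of_integral_contDiff_smul_eq_zero (μ := P' + N')
    (f := fun x => (P'.rnDeriv (P' + N') x).toReal - (N'.rnDeriv (P' + N') x).toReal)
    ((iP.sub iN).locallyIntegrable.locallyIntegrableOn _) (by
      intro g hg hc hs
      let φ : 𝓓(U, ℝ) := ⟨g, hg, hc, hs⟩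
      have := h φ
      rw [← emb.integral_map, ← emb.integral_map] at this
      have e1 := integral_rnDeriv_smul hPac (f := g)
      have e2 := integral_rnDeriv_smul hNac (f := g)
      obtain ⟨C, hC⟩ := hg.continuous.bounded_above_of_compact_support hc
      have j1 := iP.bdd_mul (f := g) hg.continuous.aestronglyMeasurable (Eventually.of_forall hC)
      have j2 := iN.bdd_mul (f := g) hg.continuous.aestronglyMeasurable (Eventually.of_forall hC)
      simp only [smul_eq_mul, mul_sub] at *
      rw [integral_sub j1 j2]
      simp only [mul_comm (g _)]
      rw [e1, e2, sub_eq_zero]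
      exact this)
  have hUc : ∀ᵐ x ∂(P' + N'), x ∈ (U : Set (EuclideanSpace ℝ (Fin m))) := by
    have : ∀ Q : Measure U, ∀ᵐ x ∂(Q.map (Subtype.val : U → EuclideanSpace ℝ (Fin m))),
        x ∈ (U : Set (EuclideanSpace ℝ (Fin m))) := fun Q => by
      rw [emb.ae_map_iff]; exact Eventually.of_forall fun x => x.2
    rw [ae_add_measure_iff]; exact ⟨this P, this N⟩
  have hae : P'.rnDeriv (P' + N') =ᵐ[P' + N'] N'.rnDeriv (P' + N') := by
    filter_upwards [key, hUc, Measure.rnDeriv_lt_top P' (P' + N'),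
      Measure.rnDeriv_lt_top N' (P' + N')] with x hx hxU h1 h2
    exact (ENNReal.toReal_eq_toReal_iff' h1.ne h2.ne).1 (sub_eq_zero.1 (hx hxU))
  have hPN : P' = N' :=
    ((Measure.withDensity_rnDeriv_eq P' _ hPac).symm.trans (withDensity_congr_ae hae)).trans
      (Measure.withDensity_rnDeriv_eq N' _ hNac)
  rw [← emb.comap_map P, ← emb.comap_map N]
  exact congrArg _ hPN

/-- The distributional divergence is unique. -/
theorem IsDivergence.unique {u : LInf U} {μ ν : SignedMeasure U} (hμ : IsDivergence u μ)
    (hν : IsDivergence u ν) : μ = ν := by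
  have h : ∀ φ : 𝓓(U, ℝ), sIntegral (fun x : U => φ x) (μ + (-1 : ℝ) • ν) = 0 := fun φ => by
    rw [sIntegral_add (continuous_test φ) (bdd_test φ), sIntegral_smul]
    linarith [hμ φ, hν φ]
  set κ := μ + (-1 : ℝ) • ν with hκ
  have h0 : κ.toJordanDecomposition.posPart = κ.toJordanDecomposition.negPart :=
    measure_ext _ _ fun φ =>
      sub_eq_zero.1 ((sIntegral_eq κ (continuous_test φ) (bdd_test φ)).symm.trans (h φ))
  have h1 : κ = 0 := by
    rw [← κ.toSignedMeasure_toJordanDecomposition, JordanDecomposition.toSignedMeasure]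
    simp only [h0, sub_self]
  have h2 : μ + (-1 : ℝ) • ν = 0 := h1
  have h3 : (-1 : ℝ) • ν = -ν := by
    ext s _
    simp
  rw [h3, ← sub_eq_add_neg] at h2
  exact sub_eq_zero.1 h2

theorem integrable_grad (φ : 𝓓(U, ℝ)) :
    Integrable (gradient φ)
      (volume.restrict (U : Set (EuclideanSpace ℝ (Fin m)))) := by
  have hc : Continuous (gradient φ) :=
    (InnerProductSpace.toDual ℝ (EuclideanSpace ℝ (Fin m))).symm.continuous.comp
      (φ.contDiff.continuous_fderiv (by simp))
  have hs : HasCompactSupport (gradient φ) :=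
    (φ.hasCompactSupport.fderiv (𝕜 := ℝ)).comp_left
      (g := (InnerProductSpace.toDual ℝ (EuclideanSpace ℝ (Fin m))).symm) (map_zero _)
  exact (hc.integrable_of_hasCompactSupport hs).restrict

theorem integrable_pairing (φ : 𝓓(U, ℝ)) (u : LInf U) :
    Integrable (fun x => inner ℝ (gradient φ x) (u x))
      (volume.restrict (U : Set (EuclideanSpace ℝ (Fin m)))) := by
  have h1 : MemLp (gradient φ) 1
      (volume.restrict (U : Set (EuclideanSpace ℝ (Fin m)))) := memLp_one_iff_integrable.2
        (integrable_grad φ)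
  have := MemLp.of_bilin (r := 1) (fun x y => inner ℝ x y) 1 h1 (Lp.memLp u)
    (h1.1.inner (Lp.memLp u).1) (Eventually.of_forall fun x => by
      rw [one_mul]
      exact norm_inner_le_norm (𝕜 := ℝ) (gradient φ x) (u x))
  exact memLp_one_iff_integrable.1 this

theorem gradPairing_add (φ : 𝓓(U, ℝ)) (u v : LInf U) :
    gradPairing φ (u + v) = gradPairing φ u + gradPairing φ v := by
  unfold gradPairing
  rw [← integral_add (integrable_pairing φ u) (integrable_pairing φ v)]
  refine integral_congr_ae ?_
  filter_upwards [Lp.coeFn_add u v] with x hx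
  rw [hx, Pi.add_apply, inner_add_right]

theorem gradPairing_smul (φ : 𝓓(U, ℝ)) (c : ℝ) (u : LInf U) :
    gradPairing φ (c • u) = c * gradPairing φ u := by
  unfold gradPairing
  rw [← integral_const_mul]
  refine integral_congr_ae ?_
  filter_upwards [Lp.coeFn_smul c u] with x hx
  rw [hx, Pi.smul_apply, inner_smul_right]

theorem IsDivergence.add {u v : LInf U} {μ ν : SignedMeasure U} (hμ : IsDivergence u μ)
    (hν : IsDivergence v ν) : IsDivergence (u + v) (μ + ν) := fun φ => by
  rw [gradPairing_add, sIntegral_add (continuous_test φ) (bdd_test φ), hμ φ, hν φ]; ring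

theorem IsDivergence.smul {u : LInf U} {μ : SignedMeasure U} (c : ℝ) (hμ : IsDivergence u μ) :
    IsDivergence (c • u) (c • μ) := fun φ => by
  rw [gradPairing_smul, sIntegral_smul, hμ φ]; ring

end Facts

/-- `DM_∞(U)`: the bounded vector fields on `U` whose distributional divergence is a finite
(signed) Radon measure on `U`. -/
def DM {m : ℕ} (U : Opens (EuclideanSpace ℝ (Fin m))) : Submodule ℝ (LInf U) where
  carrier := {u | ∃ μ : SignedMeasure U, IsDivergence u μ}
  add_mem' := fun ⟨μ, hμ⟩ ⟨ν, hν⟩ => ⟨μ + ν, hμ.add hν⟩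
  zero_mem' := ⟨(0 : ℝ) • 0, by
    simpa using IsDivergence.smul (U := U) (u := 0) (μ := 0) 0 (fun φ => by
      have h1 := gradPairing_smul φ 0 0
      have h2 := sIntegral_smul (fun x : U => φ x) 0 0
      simp only [zero_smul, zero_mul] at h1 h2
      rw [h1, h2, neg_zero])⟩
  smul_mem' := fun c _ ⟨μ, hμ⟩ => ⟨c • μ, hμ.smul c⟩

/-- The divergence measure `div u ∈ M(U)` of a field `u ∈ DM_∞(U)`. -/
noncomputable def divMeasure {m : ℕ} {U : Opens (EuclideanSpace ℝ (Fin m))} (u : DM U) :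
    SignedMeasure U :=
  u.2.choose

theorem isDivergence_divMeasure {m : ℕ} {U : Opens (EuclideanSpace ℝ (Fin m))} (u : DM U) :
    IsDivergence (u : LInf U) (divMeasure u) :=
  u.2.choose_spec

theorem divMeasure_add {m : ℕ} {U : Opens (EuclideanSpace ℝ (Fin m))} (u v : DM U) :
    divMeasure (u + v) = divMeasure u + divMeasure v :=
  (isDivergence_divMeasure (u + v)).unique
    ((isDivergence_divMeasure u).add (isDivergence_divMeasure v))

theorem divMeasure_smul {m : ℕ} {U : Opens (EuclideanSpace ℝ (Fin m))} (c : ℝ) (u : DM U) :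
    divMeasure (c • u) = c • divMeasure u :=
  (isDivergence_divMeasure (c • u)).unique ((isDivergence_divMeasure u).smul c)

/-- `DB(U)`: the closure of `DM_∞(U)` in `L_∞(U; ℝᵐ)`. Its dual `DB'(U)` is
`StrongDual ℝ (DB U)`. -/
noncomputable def DB {m : ℕ} (U : Opens (EuclideanSpace ℝ (Fin m))) : Submodule ℝ (LInf U) :=
  (DM U).topologicalClosure

/-- The inclusion of `DM_∞(U)` into `DB(U)`. -/
noncomputable def DM.toDB {m : ℕ} {U : Opens (EuclideanSpace ℝ (Fin m))} : DM U →ₗ[ℝ] DB U :=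
  Submodule.inclusion (DM U).le_topologicalClosure

/-- The σ-algebra generated by the Suslin (analytic) subsets of `U`. -/
@[reducible]
def suslin {m : ℕ} (U : Opens (EuclideanSpace ℝ (Fin m))) : MeasurableSpace U :=
  MeasurableSpace.generateFrom {s : Set U | AnalyticSet s}

/-- The completion of the Suslin σ-algebra of `U` with respect to the `(m-1)`-dimensional
Hausdorff measure on `U`. -/
@[reducible]
noncomputable def suslinCompletion {m : ℕ} (U : Opens (EuclideanSpace ℝ (Fin m))) :
    MeasurableSpace U :=
  eventuallyMeasurableSpace (suslin U) (ae (μH[(m : ℝ) - 1] : Measure U))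

/-- The bounded fluctuation seminorm
`‖f‖_{BF(U)} = sup {∫_U f d(div u) : u ∈ DM_∞(U), ‖u‖_∞ ≤ 1} ∈ [0, ∞]`. As `u = 0` is admissible,
the truncation of negative values in `ENNReal.ofReal` does not change the supremum. -/
noncomputable def bfNorm {m : ℕ} (U : Opens (EuclideanSpace ℝ (Fin m))) (f : U → ℝ) : ℝ≥0∞ :=
  ⨆ (u : DM U) (_ : ‖(u : LInf U)‖ ≤ 1), ENNReal.ofReal (sIntegral f (divMeasure u))

/-- `f ∈ BF_∞(U)`: the function `f` is bounded, measurable with respect to the completed Suslin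
σ-algebra, and has finite bounded fluctuation seminorm. -/
structure HasBoundedFluctuation {m : ℕ} (U : Opens (EuclideanSpace ℝ (Fin m))) (f : U → ℝ) :
    Prop where
  bounded : ∃ C : ℝ, ∀ x, |f x| ≤ C
  measurable : Measurable[suslinCompletion U] f
  finite : bfNorm U f < ∞

/-- The functional `L ∈ DB'(U)` satisfies `⟨L, u⟩ = - ∫_U f d(div u)` for all `u ∈ DM_∞(U)`. -/
def IsFluctuationFunctional {m : ℕ} {U : Opens (EuclideanSpace ℝ (Fin m))} (f : U → ℝ)
    (L : StrongDual ℝ (DB U)) : Prop :=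
  ∀ u : DM U, L (DM.toDB u) = - sIntegral f (divMeasure u)

open Classical in
/-- The functional `μ_f ∈ DB'(U)` of a function `f` of bounded fluctuation: the unique
continuous linear functional on `DB(U)` with `⟨μ_f, u⟩ = - ∫_U f d(div u)` for `u ∈ DM_∞(U)`.
(For functions without such a functional the value is `0`.) -/
noncomputable def fluctuationFunctional {m : ℕ} {U : Opens (EuclideanSpace ℝ (Fin m))}
    (f : U → ℝ) : StrongDual ℝ (DB U) :=
  if h : ∃ L : StrongDual ℝ (DB U), IsFluctuationFunctional f L then h.choose else 0

section Functional

variable {m : ℕ} {U : Opens (EuclideanSpace ℝ (Fin m))}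

theorem denseRange_toDB : DenseRange (DM.toDB (U := U)) := by
  rw [DenseRange, Subtype.dense_iff]
  intro x hx
  refine closure_mono ?_ (show x ∈ closure ((DM U : Submodule ℝ (LInf U)) : Set (LInf U)) from hx)
  intro y hy
  exact ⟨DM.toDB ⟨y, hy⟩, ⟨⟨y, hy⟩, rfl⟩, rfl⟩

theorem IsFluctuationFunctional.unique {f : U → ℝ} {L L' : StrongDual ℝ (DB U)}
    (hL : IsFluctuationFunctional f L) (hL' : IsFluctuationFunctional f L') : L = L' :=
  DFunLike.coe_injective (denseRange_toDB.equalizer L.continuous L'.continuous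
    (funext fun u => (hL u).trans (hL' u).symm))

theorem sIntegral_le {f : U → ℝ} (hfin : bfNorm U f < ∞) (u : DM U) :
    sIntegral f (divMeasure u) ≤ (bfNorm U f).toReal * ‖(u : LInf U)‖ := by
  have hle : ∀ v : DM U, ‖(v : LInf U)‖ ≤ 1 →
      sIntegral f (divMeasure v) ≤ (bfNorm U f).toReal := fun v hv =>
    (ENNReal.ofReal_le_iff_le_toReal hfin.ne).1
      (le_iSup₂ (f := fun (w : DM U) (_ : ‖(w : LInf U)‖ ≤ 1) =>
        ENNReal.ofReal (sIntegral f (divMeasure w))) v hv)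
  rcases eq_or_ne (‖(u : LInf U)‖) 0 with h0 | h0
  · have hu : u = (0 : ℝ) • u := by
      rw [zero_smul]; exact Subtype.ext (norm_eq_zero.1 h0)
    rw [hu, divMeasure_smul, sIntegral_smul, zero_mul]
    positivity
  · have hpos : 0 < ‖(u : LInf U)‖ := lt_of_le_of_ne (norm_nonneg _) (Ne.symm h0)
    have := hle (‖(u : LInf U)‖⁻¹ • u) (by
      rw [Submodule.coe_smul, norm_smul, norm_inv, norm_norm, inv_mul_cancel₀ h0])
    rw [divMeasure_smul, sIntegral_smul, inv_mul_le_iff₀ hpos] at this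
    linarith

/-- For continuous functions of bounded fluctuation, `fluctuationFunctional` indeed is the
functional described in its definition. -/
theorem isFluctuationFunctional {f : U → ℝ} (hf : HasBoundedFluctuation U f)
    (hc : Continuous f) : IsFluctuationFunctional f (fluctuationFunctional f) := by
  have hex : ∃ L : StrongDual ℝ (DB U), IsFluctuationFunctional f L := by
    let T : DM U →ₗ[ℝ] ℝ :=
      { toFun := fun u => - sIntegral f (divMeasure u)
        map_add' := fun u v => by
          rw [divMeasure_add, sIntegral_add hc hf.bounded]; ring
        map_smul' := fun c u => by
          rw [divMeasure_smul, sIntegral_smul]; simp }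
    refine ⟨T.extendOfNorm DM.toDB, fun u => LinearMap.extendOfNorm_eq denseRange_toDB
      ⟨(bfNorm U f).toReal, fun v => abs_le.2 ⟨?_, ?_⟩⟩ u⟩
    · have := sIntegral_le hf.finite v
      change -((bfNorm U f).toReal * ‖(v : LInf U)‖) ≤ - sIntegral f (divMeasure v)
      linarith
    · have := sIntegral_le hf.finite (-1 • v : DM U)
      rw [neg_one_smul, ← neg_one_smul ℝ v, divMeasure_smul, sIntegral_smul, neg_one_smul,
        Submodule.coe_neg, norm_neg] at this
      change - sIntegral f (divMeasure v) ≤ (bfNorm U f).toReal * ‖(v : LInf U)‖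
      linarith
  rw [fluctuationFunctional, dif_pos hex]
  exact hex.choose_spec

end Functional

end BoundedFluctuation

open BoundedFluctuation

namespace BoundedFluctuation

/-! The heart is a duality argument in place of mollification. Fix a compact `K`, `ε > 0` and `R >
‖f‖_BF`, and suppose that no test function `φ` with `‖∇φ‖₁ ≤ R` is `ε`-close to `f` on `K`. By
homogeneity, `t ≤ ε⁻¹ (‖(φ - t f)⁺‖ + ‖(φ - t f)⁻‖) + R⁻¹ ‖∇φ‖₁` for all `φ` and all real `t`, with
sup norms on `K`. Hahn–Banach extends `(φ, t) ↦ t` to a functional below this majorant, which splits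
into two positive functionals on `C(K)`, hence finite measures `P` and `Q`, and a functional of the
gradient, hence a field `u` with `‖u‖_∞ ≤ R⁻¹`. Taking `t = 0` gives `div u = P - Q`; taking `φ =
0`, `t = 1` gives `∫ f d(div u) = -1`. Testing the seminorm with `-u` yields `1 ≤ ‖f‖_BF / R < 1`, a
contradiction (`exists_field_of_not_approx`, `exists_test_approx`).

Two corrections remain. Values in `[a, b]` come from composing with a smooth nonexpansive truncation
fixing `0`. The exact bound `‖f‖_BF` comes from scaling by a factor slightly below one if the
seminorm is positive; if it vanishes, a Poincaré type inequality forces `f = 0`, and the zero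
function serves.

Weak* convergence on `DM U` is dominated convergence against the divergence measure; the uniform
`L₁` bound on the gradients carries it over to the closure `DB U`. -/

/-! ### Hahn–Banach along a linear map -/

/-- Hahn–Banach for a sublinear majorant, along a linear map `J` that need not be injective. -/
theorem exists_extension_along {V E : Type*} [AddCommGroup V] [Module ℝ V] [AddCommGroup E]
    [Module ℝ E] (J : V →ₗ[ℝ] E) (T : V →ₗ[ℝ] ℝ) (N : E → ℝ)
    (N_hom : ∀ c : ℝ, 0 < c → ∀ x, N (c • x) = c * N x) (N_add : ∀ x y, N (x + y) ≤ N x + N y)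
    (h : ∀ v, T v ≤ N (J v)) :
    ∃ g : E →ₗ[ℝ] ℝ, (∀ v, g (J v) = T v) ∧ ∀ x, g x ≤ N x := by
  have N_0 : N 0 = 0 := by
    have := N_hom 2 (by norm_num) 0
    rw [smul_zero] at this
    linarith
  -- Since `N 0 = 0`, the majorant at `v` and `-v` forces `T v = 0` on the kernel of `J`, so `T`
  -- descends to the range.
  have hker : LinearMap.ker J ≤ LinearMap.ker T := fun v hv => by
    rw [LinearMap.mem_ker] at hv ⊢
    have h1 := h v
    have h2 := h (-v)
    rw [map_neg, map_neg, hv, neg_zero, N_0] at h2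
    rw [hv, N_0] at h1
    linarith
  let T' : LinearMap.range J →ₗ[ℝ] ℝ :=
    (LinearMap.ker J).liftQ T hker ∘ₗ J.quotKerEquivRange.symm.toLinearMap
  have hT' : ∀ v, T' ⟨J v, LinearMap.mem_range_self J v⟩ = T v := fun v => by
    have : J.quotKerEquivRange.symm ⟨J v, LinearMap.mem_range_self J v⟩
        = (LinearMap.ker J).mkQ v := J.quotKerEquivRange_symm_apply_image v _
    simp only [T', LinearMap.comp_apply, LinearEquiv.coe_coe, this]
    exact Submodule.liftQ_apply _ _ _
  obtain ⟨g, hg, hgN⟩ := exists_extension_of_le_sublinear ⟨LinearMap.range J, T'⟩ N N_hom N_add (by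
    rintro ⟨_, v, rfl⟩
    exact (hT' v).trans_le (h v))
  exact ⟨g, fun v => (hg ⟨J v, LinearMap.mem_range_self J v⟩).trans (hT' v), hgN⟩

/-! ### Functionals on `L²` with a weighted `L¹` majorant -/

section WeightedBound

variable {α F : Type*} [MeasurableSpace α] {μ : Measure α} [NormedAddCommGroup F]

theorem integrable_weight_mul_norm {ρ : α → ℝ} (hρ : MemLp ρ 2 μ) (h : Lp F 2 μ) :
    Integrable (fun x => ρ x * ‖h x‖) μ :=
  hρ.integrable_mul (Lp.memLp h).norm

variable [InnerProductSpace ℝ F]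

/-- A square integrable field whose `L²`-pairing is controlled by a weighted `L¹`-norm is pointwise
controlled by the weight. -/
theorem ae_norm_le_of_inner_le {ρ : α → ℝ} (hρ : MemLp ρ 2 μ) (hρm : Measurable ρ) {C : ℝ}
    (hC : 0 ≤ C) (hρ0 : ∀ x, 0 ≤ ρ x) (v : Lp F 2 μ)
    (h : ∀ w : Lp F 2 μ, inner ℝ v w ≤ C * ∫ x, ρ x * ‖w x‖ ∂μ) :
    ∀ᵐ x ∂μ, ‖v x‖ ≤ C * ρ x := by
  -- Test with `v` cut off to the set `A` where the bound fails: `∫_A (‖v‖² - C ρ ‖v‖) ≤ 0`,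
  -- although the integrand is positive on `A`. Hence `A` is null.
  set A : Set α := {x | C * ρ x < ‖v x‖} with hA
  have hAm : MeasurableSet A :=
    measurableSet_lt (hρm.const_mul C) (Lp.stronglyMeasurable v).norm.measurable
  have hw := (Lp.memLp v).indicator hAm
  set w : Lp F 2 μ := hw.toLp _ with hwdef
  have hwv : w =ᵐ[μ] A.indicator v := hw.coeFn_toLp
  have i1 : Integrable (fun x => ‖w x‖ * ‖w x‖) μ :=
    (Lp.memLp w).norm.integrable_mul (Lp.memLp w).norm
  have i2 : Integrable (fun x => C * (ρ x * ‖w x‖)) μ :=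
    (integrable_weight_mul_norm hρ w).const_mul C
  have e1 : inner ℝ v w = ∫ x, ‖w x‖ * ‖w x‖ ∂μ := by
    rw [L2.inner_def]
    refine integral_congr_ae ?_
    filter_upwards [hwv] with x hx
    rw [hx]
    by_cases hxA : x ∈ A
    · rw [Set.indicator_of_mem hxA, real_inner_self_eq_norm_mul_norm]
    · rw [Set.indicator_of_notMem hxA, inner_zero_right, norm_zero, zero_mul]
  have e2 : ∫ x, (‖w x‖ * ‖w x‖ - C * (ρ x * ‖w x‖)) ∂μ ≤ 0 := by
    rw [integral_sub i1 i2, integral_const_mul, ← e1]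
    linarith [h w]
  have e3 : 0 ≤ᵐ[μ] fun x => ‖w x‖ * ‖w x‖ - C * (ρ x * ‖w x‖) := by
    filter_upwards [hwv] with x hx
    by_cases hxA : x ∈ A
    · have h1 : C * ρ x ≤ ‖v x‖ := le_of_lt hxA
      rw [hx, Set.indicator_of_mem hxA]
      have := mul_le_mul_of_nonneg_right h1 (norm_nonneg (v x))
      simp only [Pi.zero_apply]
      linarith
    · rw [hx, Set.indicator_of_notMem hxA]
      simp
  have e4 := (integral_eq_zero_iff_of_nonneg_ae e3 (i1.sub i2)).1
    (le_antisymm e2 (integral_nonneg_of_ae e3))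
  filter_upwards [hwv, e4] with x hx hx4
  by_contra hlt
  have hxA : x ∈ A := not_le.1 hlt
  have h1 : C * ρ x < ‖v x‖ := hxA
  have h0 : 0 < ‖v x‖ := lt_of_le_of_lt (mul_nonneg hC (hρ0 x)) h1
  rw [hx, Set.indicator_of_mem hxA] at hx4
  have := mul_lt_mul_of_pos_right h1 h0
  simp only [Pi.zero_apply] at hx4
  linarith

/-- A linear functional on `L²` controlled by a weighted `L¹`-norm is the pairing with a field
controlled by the weight. -/
theorem exists_inner_eq_of_le [CompleteSpace F] {ρ : α → ℝ} (hρ : MemLp ρ 2 μ)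
    (hρm : Measurable ρ) {C : ℝ} (hC : 0 ≤ C) (hρ0 : ∀ x, 0 ≤ ρ x) (l : Lp F 2 μ →ₗ[ℝ] ℝ)
    (h : ∀ w, l w ≤ C * ∫ x, ρ x * ‖w x‖ ∂μ) :
    ∃ v : Lp F 2 μ, (∀ w, l w = ∫ x, inner ℝ (v x) (w x) ∂μ) ∧ ∀ᵐ x ∂μ, ‖v x‖ ≤ C * ρ x := by
  have hle : ∀ w : Lp F 2 μ, l w ≤ C * ‖hρ.toLp ρ‖ * ‖w‖ := fun w => by
    -- The majorant is the `L²` pairing of `ρ` with `‖w‖`, so Cauchy–Schwarz makes `l` continuous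
    -- and the Hilbert space representation applies.
    have e : ∫ x, ρ x * ‖w x‖ ∂μ = inner ℝ (hρ.toLp ρ) (Lp.memLp w).norm.toLp := by
      rw [L2.inner_def]
      refine integral_congr_ae ?_
      filter_upwards [hρ.coeFn_toLp, (Lp.memLp w).norm.coeFn_toLp] with x h1 h2
      rw [h1, h2, real_inner_eq_re_inner]
      simp [mul_comm]
    have e2 : ‖(Lp.memLp w).norm.toLp‖ = ‖w‖ := by
      rw [Lp.norm_toLp, eLpNorm_norm, Lp.norm_def]
    refine (h w).trans ?_
    rw [e, mul_assoc]
    gcongr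
    exact (real_inner_le_norm _ _).trans_eq (by rw [e2])
  let L : StrongDual ℝ (Lp F 2 μ) := l.mkContinuous (C * ‖hρ.toLp ρ‖) fun w => abs_le.2
    ⟨by have := hle (-w); rw [map_neg, norm_neg] at this; linarith, hle w⟩
  set v := (InnerProductSpace.toDual ℝ (Lp F 2 μ)).symm L with hv
  have hvL : ∀ w, inner ℝ v w = l w := fun w => InnerProductSpace.toDual_symm_apply
  refine ⟨v, fun w => ?_, ae_norm_le_of_inner_le hρ hρm hC hρ0 v fun w => ?_⟩
  · rw [← hvL, L2.inner_def]
  · rw [hvL]; exact h w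

end WeightedBound

/-! ### Positive functionals on `C(X)` -/

section PositiveFunctional

variable {X : Type*} [TopologicalSpace X] [CompactSpace X]

/-- Riesz–Markov–Kakutani on a compact space, for functionals with a sublinear majorant depending
only on positive parts. -/
theorem exists_measure_of_le_norm_posPart [T2Space X] [MeasurableSpace X] [BorelSpace X]
    (l : C(X, ℝ) →ₗ[ℝ] ℝ) (C : ℝ) (h : ∀ g, l g ≤ C * ‖g ⊔ 0‖) :
    ∃ P : Measure X, IsFiniteMeasure P ∧ ∀ g : C(X, ℝ), l g = ∫ x, g x ∂P := by
  -- For `g ≥ 0` the positive part of `-g` is zero, so `l (-g) ≤ 0`.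
  have hpos : ∀ g : C(X, ℝ), 0 ≤ g → 0 ≤ l g := fun g hg => by
    have := h (-g)
    rw [map_neg, sup_eq_right.2 (neg_nonpos.2 hg), norm_zero, mul_zero] at this
    linarith
  let l' : CompactlySupportedContinuousMap X ℝ →ₗ[ℝ] ℝ :=
    { toFun := fun g => l g.toContinuousMap
      map_add' := fun g g' => l.map_add g.toContinuousMap g'.toContinuousMap
      map_smul' := fun c g => l.map_smul c g.toContinuousMap }
  let Λ := PositiveLinearMap.mk₀ l' fun g hg => hpos _ hg
  refine ⟨RealRMK.rieszMeasure Λ, inferInstance, fun g => ?_⟩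
  exact (RealRMK.integral_rieszMeasure Λ ⟨g, HasCompactSupport.of_compactSpace g⟩).symm

/-- Subadditivity here and homogeneity in `norm_posPart_smul` make `g ↦ ‖g⁺‖` an admissible term of
a Hahn–Banach majorant. -/
theorem norm_posPart_add_le (g g' : C(X, ℝ)) : ‖(g + g') ⊔ 0‖ ≤ ‖g ⊔ 0‖ + ‖g' ⊔ 0‖ := by
  rw [ContinuousMap.norm_le _ (by positivity)]
  intro x
  have h1 := (g ⊔ 0).norm_coe_le_norm x
  have h2 := (g' ⊔ 0).norm_coe_le_norm x
  simp only [ContinuousMap.sup_apply, ContinuousMap.add_apply, ContinuousMap.zero_apply,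
    Real.norm_eq_abs, abs_of_nonneg (le_max_right _ (0 : ℝ)), ge_iff_le] at *
  exact max_le (by linarith [le_max_left (g x) 0, le_max_left (g' x) 0])
    (by linarith [le_max_right (g x) 0, le_max_right (g' x) 0])

theorem norm_posPart_smul {c : ℝ} (hc : 0 < c) (g : C(X, ℝ)) :
    ‖(c • g) ⊔ 0‖ = c * ‖g ⊔ 0‖ := by
  have : (c • g) ⊔ 0 = c • (g ⊔ 0) := by
    ext x
    simp [mul_max_of_nonneg _ _ hc.le]
  rw [this, norm_smul, Real.norm_of_nonneg hc.le]

end PositiveFunctional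

/-! ### A positive square integrable weight -/

section Weight

variable {E : Type*} [NormedAddCommGroup E] [NormedSpace ℝ E] [FiniteDimensional ℝ E]
  [MeasurableSpace E] [BorelSpace E]

/-- There is a continuous, positive, square integrable weight. -/
theorem exists_continuous_pos_memLp_two (μ : Measure E) [μ.IsAddHaarMeasure] :
    ∃ ρ : E → ℝ, Continuous ρ ∧ (∀ x, 0 < ρ x) ∧ MemLp ρ 2 μ := by
  have h0 : ∀ x : E, 0 < 1 + ‖x‖ := fun x => by positivity
  have hc : Continuous fun x : E => (1 + ‖x‖) ^ (-((Module.finrank ℝ E : ℝ) + 1)) :=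
    (continuous_const.add continuous_norm).rpow_const fun x => Or.inl (h0 x).ne'
  refine ⟨_, hc, fun x => Real.rpow_pos_of_pos (h0 x) _, ?_⟩
  rw [memLp_two_iff_integrable_sq hc.aestronglyMeasurable]
  -- The square decays with exponent `2 (d + 1)`, which exceeds the dimension `d`.
  have := integrable_one_add_norm (μ := μ) (E := E)
    (r := 2 * ((Module.finrank ℝ E : ℝ) + 1))
    (by linarith [Nat.cast_nonneg (α := ℝ) (Module.finrank ℝ E)])
  refine this.congr (Eventually.of_forall fun x => ?_)
  simp only
  rw [← Real.rpow_natCast, ← Real.rpow_mul (h0 x).le]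
  congr 1
  push_cast
  ring

end Weight

/-! ### Test functions and their weighted gradients -/

variable {m : ℕ} {U : Opens (EuclideanSpace ℝ (Fin m))}

theorem differentiable_test (φ : 𝓓(U, ℝ)) : Differentiable ℝ φ :=
  φ.contDiff.differentiable (by simp)

theorem gradient_test_add (φ ψ : 𝓓(U, ℝ)) (x : EuclideanSpace ℝ (Fin m)) :
    gradient (φ + ψ : 𝓓(U, ℝ)) x = gradient φ x + gradient ψ x := by
  rw [FunLike.coe_add, gradient, fderiv_add (differentiable_test φ x) (differentiable_test ψ x),
    map_add]
  rfl

theorem gradient_test_smul (c : ℝ) (φ : 𝓓(U, ℝ)) (x : EuclideanSpace ℝ (Fin m)) :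
    gradient (c • φ : 𝓓(U, ℝ)) x = c • gradient φ x := by
  rw [FunLike.coe_smul, gradient, fderiv_const_smul (differentiable_test φ x), map_smul]
  rfl

theorem continuous_gradient_test (φ : 𝓓(U, ℝ)) : Continuous (gradient φ) :=
  (InnerProductSpace.toDual ℝ (EuclideanSpace ℝ (Fin m))).symm.continuous.comp
    (φ.contDiff.continuous_fderiv (by simp))

theorem hasCompactSupport_gradient_test (φ : 𝓓(U, ℝ)) : HasCompactSupport (gradient φ) :=
  (φ.hasCompactSupport.fderiv (𝕜 := ℝ)).comp_left
    (g := (InnerProductSpace.toDual ℝ (EuclideanSpace ℝ (Fin m))).symm) (map_zero _)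

/-- Restriction of test functions to a subset of `U`, as a linear map. -/
noncomputable def restrictTest (K : Set U) : 𝓓(U, ℝ) →ₗ[ℝ] C(K, ℝ) where
  toFun φ := ⟨fun x => φ x, (continuous_test φ).comp continuous_subtype_val⟩
  map_add' _ _ := rfl
  map_smul' _ _ := rfl

section WeightedGradient

/-- The inverse weight may be unbounded at infinity, but the gradient has compact support. -/
theorem memLp_weighted_gradient {ρ : EuclideanSpace ℝ (Fin m) → ℝ} (hρ : Continuous ρ)
    (hρ0 : ∀ x, 0 < ρ x) (φ : 𝓓(U, ℝ)) :
    MemLp (fun x => (ρ x)⁻¹ • gradient φ x) 2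
      (volume.restrict (U : Set (EuclideanSpace ℝ (Fin m)))) :=
  (((hρ.inv₀ fun x => (hρ0 x).ne').smul (continuous_gradient_test φ)).memLp_of_hasCompactSupport
    (hasCompactSupport_gradient_test φ).smul_left).restrict _

variable {ρ : EuclideanSpace ℝ (Fin m) → ℝ} (hρ : Continuous ρ) (hρ0 : ∀ x, 0 < ρ x)

/-- The weighted gradient `φ ↦ ρ⁻¹ ∇φ` as a linear map into `L²`. -/
noncomputable def weightedGradient : 𝓓(U, ℝ) →ₗ[ℝ] Lp (EuclideanSpace ℝ (Fin m)) 2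
    (volume.restrict (U : Set (EuclideanSpace ℝ (Fin m)))) where
  toFun φ := (memLp_weighted_gradient hρ hρ0 φ).toLp _
  map_add' φ ψ := by
    rw [← MemLp.toLp_add]
    congr 1
    ext1 x
    simp only [Pi.add_apply, gradient_test_add, smul_add]
  map_smul' c φ := by
    rw [RingHom.id_apply, ← MemLp.toLp_const_smul]
    congr 1
    ext1 x
    simp only [Pi.smul_apply, gradient_test_smul, smul_comm c]

theorem weightedGradient_ae (φ : 𝓓(U, ℝ)) : weightedGradient hρ hρ0 φ
    =ᵐ[volume.restrict (U : Set (EuclideanSpace ℝ (Fin m)))] fun x => (ρ x)⁻¹ • gradient φ x :=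
  (memLp_weighted_gradient hρ hρ0 φ).coeFn_toLp

/-- The weights cancel. Thus `‖∇φ‖₁` becomes a sublinear functional on a Hilbert space, where
duality is elementary, and a representing field below a multiple of `ρ` corresponds to a bounded
field. -/
theorem integral_weightedGradient (φ : 𝓓(U, ℝ)) :
    ∫ x in (U : Set (EuclideanSpace ℝ (Fin m))), ρ x * ‖weightedGradient hρ hρ0 φ x‖
      = ∫ x in (U : Set (EuclideanSpace ℝ (Fin m))), ‖gradient φ x‖ := by
  refine integral_congr_ae ?_
  filter_upwards [weightedGradient_ae hρ hρ0 φ] with x hx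
  rw [hx, norm_smul, norm_inv, Real.norm_of_nonneg (hρ0 x).le,
    mul_inv_cancel_left₀ (hρ0 x).ne']

end WeightedGradient

/-- The signed measure on `U` induced by two finite measures on a subset `K`. -/
theorem exists_signedMeasure_of_measures {K : Set U} (P Q : Measure K) [IsFiniteMeasure P]
    [IsFiniteMeasure Q] : ∃ μ : SignedMeasure U, ∀ f : U → ℝ, Continuous f →
      (∃ C : ℝ, ∀ x, |f x| ≤ C) → sIntegral f μ = ∫ x : K, f x ∂P - ∫ x : K, f x ∂Q := by
  refine ⟨(P.map Subtype.val).toSignedMeasure - (Q.map Subtype.val).toSignedMeasure,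
    fun f hf hb => ?_⟩
  rw [sIntegral, VectorMeasure.integral_sub_vectorMeasure (integrable_of_bdd _ hf hb)
    (integrable_of_bdd _ hf hb), VectorMeasure.integral_toSignedMeasure,
    VectorMeasure.integral_toSignedMeasure,
    integral_map measurable_subtype_coe.aemeasurable hf.aestronglyMeasurable,
    integral_map measurable_subtype_coe.aemeasurable hf.aestronglyMeasurable]

/-! ### Approximation by duality -/

/-- The duality core of the approximation: if no test function with gradient of `L₁`-norm at most
`R` is `ε`-close to `f` on the compact set `K`, then some field of norm at most `R⁻¹` has a
divergence that gives `f` the integral `-1`. -/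
theorem exists_field_of_not_approx {f : U → ℝ} (hf : Continuous f)
    (hb : ∃ C : ℝ, ∀ x, |f x| ≤ C) {K : Set U} (hK : IsCompact K) {ε R : ℝ} (hε : 0 < ε)
    (hR : 0 < R) (h : ∀ φ : 𝓓(U, ℝ), (∀ x ∈ K, |φ x - f x| ≤ ε) →
      R < ∫ x in (U : Set (EuclideanSpace ℝ (Fin m))), ‖gradient φ x‖) :
    ∃ (u : LInf U) (μ : SignedMeasure U), IsDivergence u μ ∧ ‖u‖ ≤ R⁻¹ ∧ sIntegral f μ = -1 := by
  have : CompactSpace K := isCompact_iff_compactSpace.1 hK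
  obtain ⟨ρ, hρ, hρ0, hρ2⟩ := exists_continuous_pos_memLp_two
    (volume : Measure (EuclideanSpace ℝ (Fin m)))
  set μU := (volume : Measure (EuclideanSpace ℝ (Fin m))).restrict
    (U : Set (EuclideanSpace ℝ (Fin m))) with hμU
  replace hρ2 : MemLp ρ 2 μU := hρ2.restrict _
  let fK : C(K, ℝ) := ⟨fun x => f x, hf.comp continuous_subtype_val⟩
  let D := weightedGradient (U := U) hρ hρ0
  -- The extra variable `t` homogenises the problem: `r (φ, t)` is `φ - t f` on `K`. Both `r` and
  -- `-r` enter `J`, so that the majorant only sees positive parts and the components of the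
  -- extension are positive.
  let r : 𝓓(U, ℝ) × ℝ →ₗ[ℝ] C(K, ℝ) :=
    (restrictTest K).comp (LinearMap.fst ℝ _ _) - (LinearMap.snd ℝ _ _).smulRight fK
  let J : 𝓓(U, ℝ) × ℝ →ₗ[ℝ] C(K, ℝ) × C(K, ℝ) × Lp (EuclideanSpace ℝ (Fin m)) 2 μU :=
    r.prod ((-r).prod (D.comp (LinearMap.fst ℝ _ _)))
  let I : Lp (EuclideanSpace ℝ (Fin m)) 2 μU → ℝ := fun w => ∫ x, ρ x * ‖w x‖ ∂μU
  have I_add : ∀ w w', I (w + w') ≤ I w + I w' := fun w w' => by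
    simp only [I]
    rw [← integral_add (integrable_weight_mul_norm hρ2 w) (integrable_weight_mul_norm hρ2 w')]
    refine integral_mono_ae (integrable_weight_mul_norm hρ2 _)
      ((integrable_weight_mul_norm hρ2 w).add (integrable_weight_mul_norm hρ2 w')) ?_
    filter_upwards [Lp.coeFn_add w w'] with x hx
    rw [hx, Pi.add_apply, ← mul_add]
    exact mul_le_mul_of_nonneg_left (norm_add_le _ _) (hρ0 x).le
  have I_smul : ∀ (c : ℝ) w, 0 < c → I (c • w) = c * I w := fun c w hc => by
    simp only [I]
    rw [← integral_const_mul]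
    refine integral_congr_ae ?_
    filter_upwards [Lp.coeFn_smul c w] with x hx
    rw [hx, Pi.smul_apply, norm_smul, Real.norm_of_nonneg hc.le]
    ring
  have I_zero : I 0 = 0 := by
    have := I_smul 2 0 two_pos
    rw [smul_zero] at this
    linarith
  have I_nonneg : ∀ w, 0 ≤ I w := fun w =>
    integral_nonneg fun x => mul_nonneg (hρ0 x).le (norm_nonneg _)
  let N : C(K, ℝ) × C(K, ℝ) × Lp (EuclideanSpace ℝ (Fin m)) 2 μU → ℝ := fun p =>
    ε⁻¹ * ‖p.1 ⊔ 0‖ + ε⁻¹ * ‖p.2.1 ⊔ 0‖ + R⁻¹ * I p.2.2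
  have εpos := inv_pos.2 hε
  have Rpos := inv_pos.2 hR
  obtain ⟨g, hgJ, hgN⟩ := exists_extension_along J (LinearMap.snd ℝ _ _) N (fun c hc p => by
      simp only [N, Prod.smul_fst, Prod.smul_snd, norm_posPart_smul hc, I_smul c _ hc]
      ring) (fun p q => by
      have h1 := mul_le_mul_of_nonneg_left (norm_posPart_add_le p.1 q.1) εpos.le
      have h2 := mul_le_mul_of_nonneg_left (norm_posPart_add_le p.2.1 q.2.1) εpos.le
      have h3 := mul_le_mul_of_nonneg_left (I_add p.2.2 q.2.2) Rpos.le
      simp only [N, Prod.fst_add, Prod.snd_add]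
      linarith) (by
      rintro ⟨φ, t⟩
      have n1 := mul_nonneg εpos.le (norm_nonneg (r (φ, t) ⊔ 0))
      have n2 := mul_nonneg εpos.le (norm_nonneg ((-r (φ, t)) ⊔ 0))
      have n3 := mul_nonneg Rpos.le (I_nonneg (D φ))
      change t ≤ ε⁻¹ * ‖r (φ, t) ⊔ 0‖ + ε⁻¹ * ‖(-r (φ, t)) ⊔ 0‖ + R⁻¹ * I (D φ)
      rcases le_or_gt t 0 with ht | ht
      · linarith
      -- For `t > 0` compare `φ / t` with `f`. If they are close on `K`, the hypothesis gives `‖∇φ‖₁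
      -- > t R`; otherwise `|φ - t f| > t ε` at some point of `K`, and one of the two positive parts
      -- already bounds `t`.
      by_cases hφ : ∀ x ∈ K, |(t⁻¹ • φ : 𝓓(U, ℝ)) x - f x| ≤ ε
      · have h1 := h _ hφ
        simp only [gradient_test_smul, norm_smul, norm_inv, Real.norm_of_nonneg ht.le,
          integral_const_mul] at h1
        rw [← integral_weightedGradient hρ hρ0, lt_inv_mul_iff₀ ht] at h1
        change t * R < I (D φ) at h1
        have : t ≤ R⁻¹ * I (D φ) := by
          rw [le_inv_mul_iff₀ hR]; linarith
        linarith
      · push Not at hφ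
        obtain ⟨x, hxK, hx⟩ := hφ
        have e : (t⁻¹ • φ : 𝓓(U, ℝ)) x - f x = t⁻¹ * r (φ, t) ⟨x, hxK⟩ := by
          change t⁻¹ * φ x - f x = t⁻¹ * (φ x - t * f x)
          field_simp
        rw [e, abs_mul, abs_of_pos (inv_pos.2 ht), lt_inv_mul_iff₀ ht] at hx
        have a1 := (r (φ, t) ⊔ 0).norm_coe_le_norm ⟨x, hxK⟩
        have a2 := ((-r (φ, t)) ⊔ 0).norm_coe_le_norm ⟨x, hxK⟩
        have b1 : r (φ, t) ⟨x, hxK⟩ ≤ ‖r (φ, t) ⊔ 0‖ :=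
          (le_max_left _ _).trans ((Real.le_norm_self _).trans a1)
        have b2 : - r (φ, t) ⟨x, hxK⟩ ≤ ‖(-r (φ, t)) ⊔ 0‖ :=
          (le_max_left _ _).trans ((Real.le_norm_self _).trans a2)
        rcases abs_cases (r (φ, t) ⟨x, hxK⟩) with ⟨hc, -⟩ | ⟨hc, -⟩
        · have : t ≤ ε⁻¹ * ‖r (φ, t) ⊔ 0‖ := by
            rw [le_inv_mul_iff₀ hε]; linarith
          linarith
        · have : t ≤ ε⁻¹ * ‖(-r (φ, t)) ⊔ 0‖ := by
            rw [le_inv_mul_iff₀ hε]; linarith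
          linarith)
  let l₁ := g.comp (LinearMap.inl ℝ _ _)
  let l₂ := g.comp ((LinearMap.inr ℝ _ _).comp (LinearMap.inl ℝ _ _))
  let l₃ := g.comp ((LinearMap.inr ℝ _ _).comp (LinearMap.inr ℝ _ _))
  -- The functional is the sum of its components, and each inherits its own term of `N` because the
  -- other terms vanish at zero.
  have hg : ∀ p, g p = l₁ p.1 + l₂ p.2.1 + l₃ p.2.2 := fun p => by
    simp only [l₁, l₂, l₃, LinearMap.comp_apply, ← map_add]
    simp
  obtain ⟨P, hPf, hP⟩ := exists_measure_of_le_norm_posPart l₁ ε⁻¹ fun q =>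
    (hgN (q, 0, 0)).trans_eq (by simp [N, I_zero])
  obtain ⟨Q, hQf, hQ⟩ := exists_measure_of_le_norm_posPart l₂ ε⁻¹ fun q => by
    simpa [l₂, N, I_zero] using hgN (0, q, 0)
  obtain ⟨v, hv, hvρ⟩ := exists_inner_eq_of_le hρ2 hρ.measurable Rpos.le (fun x => (hρ0 x).le) l₃
    fun w => by simpa [l₃, N, I] using hgN (0, 0, w)
  obtain ⟨μ, hμ⟩ := exists_signedMeasure_of_measures P Q
  have hubd : ∀ᵐ x ∂μU, ‖(ρ x)⁻¹ • v x‖ ≤ R⁻¹ := by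
    filter_upwards [hvρ] with x hx
    rw [norm_smul, norm_inv, Real.norm_of_nonneg (hρ0 x).le, inv_mul_le_iff₀ (hρ0 x)]
    linarith
  have hum : MemLp (fun x => (ρ x)⁻¹ • v x) ∞ μU := memLp_top_of_bound
    ((hρ.inv₀ fun x => (hρ0 x).ne').aestronglyMeasurable.smul (Lp.aestronglyMeasurable v)) _ hubd
  refine ⟨hum.toLp _, μ, fun φ => ?_, ?_, ?_⟩
  -- At `t = 0` the extension vanishes: `∫ φ dP - ∫ φ dQ + ∫ ∇φ · u = 0` with `u = ρ⁻¹ v`, which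
  -- says `div u = P - Q`.
  · have h1 : g (J (φ, 0)) = 0 := hgJ (φ, 0)
    have h2 : r (φ, 0) = restrictTest K φ := by
      simp [r]
    rw [hg] at h1
    change l₁ (r (φ, 0)) + l₂ (-r (φ, 0)) + l₃ (D φ) = 0 at h1
    rw [h2, map_neg, hP, hQ, hv] at h1
    rw [hμ _ (continuous_test φ) (bdd_test φ)]
    have h3 : gradPairing φ (hum.toLp _) = ∫ x, inner ℝ (v x) (D φ x) ∂μU := by
      rw [gradPairing]
      refine integral_congr_ae ?_
      filter_upwards [hum.coeFn_toLp, weightedGradient_ae hρ hρ0 φ] with x hx1 hx2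
      rw [hx1, hx2, inner_smul_right, inner_smul_right, real_inner_comm]
    rw [h3]
    change ∫ x : K, φ x ∂P + -∫ x : K, φ x ∂Q + _ = 0 at h1
    linarith
  · rw [Lp.norm_toLp]
    refine ENNReal.toReal_le_of_le_ofReal Rpos.le ?_
    rw [eLpNorm_exponent_top]
    exact eLpNormEssSup_le_of_ae_bound hubd
  -- At `φ = 0`, `t = 1` the extension gives `-∫ f dP + ∫ f dQ = 1`.
  · have h1 : g (J (0, 1)) = 1 := hgJ (0, 1)
    have h2 : r (0, 1) = -fK := by
      simp [r]
    rw [hg] at h1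
    change l₁ (r (0, 1)) + l₂ (-r (0, 1)) + l₃ (D 0) = 1 at h1
    rw [h2, map_zero, map_zero, map_neg, map_neg, map_neg, hP, hQ] at h1
    rw [hμ f hf hb]
    change -∫ x : K, f x ∂P + - -∫ x : K, f x ∂Q + 0 = 1 at h1
    linarith

/-- A continuous function of bounded fluctuation is approximated, uniformly on compact sets, by test
functions whose gradients almost respect the bound given by the seminorm. -/
theorem exists_test_approx {f : U → ℝ} (hf : HasBoundedFluctuation U f) (hc : Continuous f)
    {K : Set U} (hK : IsCompact K) {ε R : ℝ} (hε : 0 < ε) (hR : (bfNorm U f).toReal < R) :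
    ∃ φ : 𝓓(U, ℝ), (∀ x ∈ K, |φ x - f x| ≤ ε) ∧
      ∫ x in (U : Set (EuclideanSpace ℝ (Fin m))), ‖gradient φ x‖ ≤ R := by
  by_contra! hcon
  have R0 : 0 < R := lt_of_le_of_lt ENNReal.toReal_nonneg hR
  obtain ⟨u, μ, hu, hun, hfμ⟩ := exists_field_of_not_approx hc hf.bounded hK hε R0 hcon
  let u' : DM U := ⟨u, μ, hu⟩
  have e : divMeasure u' = μ := (isDivergence_divMeasure u').unique hu
  -- The field `-u` gives `f` the integral `1`, hence `1 ≤ ‖f‖_BF ‖u‖ ≤ ‖f‖_BF / R < 1`.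
  have := sIntegral_le hf.finite ((-1 : ℝ) • u')
  rw [divMeasure_smul, sIntegral_smul, e, hfμ, Submodule.coe_smul, norm_smul, norm_neg, norm_one,
    one_mul] at this
  change -1 * -1 ≤ (bfNorm U f).toReal * ‖u‖ at this
  have h2 : (bfNorm U f).toReal * ‖u‖ ≤ (bfNorm U f).toReal * R⁻¹ :=
    mul_le_mul_of_nonneg_left hun ENNReal.toReal_nonneg
  have h3 : (bfNorm U f).toReal * R⁻¹ < R * R⁻¹ := mul_lt_mul_of_pos_right hR (inv_pos.2 R0)
  rw [mul_inv_cancel₀ R0.ne'] at h3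
  linarith

/-! ### Smooth truncation to `[a, b]` -/

/-- A smooth truncation to `[a, b]` that is a nonexpansive perturbation of the identity there. -/
theorem exists_smooth_truncation {a b : ℝ} (ha : a ≤ 0) (hb : 0 ≤ b) {δ : ℝ} (hδ : 0 < δ) :
    ∃ θ : ℝ → ℝ, ContDiff ℝ (⊤ : ℕ∞) θ ∧ θ 0 = 0 ∧ (∀ t, θ t ∈ Set.Icc a b) ∧
      (∀ t, |deriv θ t| ≤ 1) ∧ ∀ s ∈ Set.Icc a b, ∀ t, |θ t - s| ≤ |t - s| + δ := by
  rcases eq_or_lt_of_le (ha.trans hb) with hab | hab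
  · refine ⟨fun _ => 0, contDiff_const, rfl, fun _ => ⟨ha, hb⟩, fun t => by simp, ?_⟩
    rintro s ⟨h1, h2⟩ t
    have : s = 0 := by linarith
    simp only [this, sub_self, abs_zero]
    positivity
  set rO := (b - a) / 2 with hrO
  have rO0 : 0 < rO := by rw [hrO]; linarith
  -- The derivative of `θ` will be a bump supported in `[a, b]` and equal to `1` on `[a + κ, b -
  -- κ]`. Here `2 κ ≤ δ` controls the loss, and `κ ≤ rO / 2` keeps the inner radius positive.
  set κ := min (δ / 2) (rO / 2) with hκ
  have κ1 : κ ≤ δ / 2 := min_le_left _ _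
  have κ2 : κ ≤ rO / 2 := min_le_right _ _
  have κ0 : 0 < κ := lt_min (by linarith) (by linarith)
  let χ : ContDiffBump ((a + b) / 2 : ℝ) := ⟨rO - κ, rO, by linarith, by linarith⟩
  have χs : ContDiff ℝ (⊤ : ℕ∞) χ := χ.contDiff
  have χc : Continuous χ := χ.continuous
  have χi : ∀ s t, IntervalIntegrable χ volume s t := fun s t => χc.intervalIntegrable s t
  let θ : ℝ → ℝ := fun t => ∫ x in (0 : ℝ)..t, χ x
  have hθ : ∀ t, HasDerivAt θ (χ t) t := fun t =>
    intervalIntegral.integral_hasDerivAt_right (χi _ _) (χc.stronglyMeasurableAtFilter _ _)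
      χc.continuousAt
  have θd : deriv θ = χ := funext fun t => (hθ t).deriv
  have θdiff : Differentiable ℝ θ := fun t => (hθ t).differentiableAt
  have θ0 : θ 0 = 0 := intervalIntegral.integral_same
  have hsub : ∀ s t, θ t - θ s = ∫ x in s..t, χ x := fun s t =>
    intervalIntegral.integral_interval_sub_left (χi _ _) (χi _ _)
  have mono1 : Monotone θ := monotone_of_deriv_nonneg θdiff fun t => by
    rw [θd]; exact χ.nonneg
  have mono2 : Monotone fun t => t - θ t :=
    monotone_of_deriv_nonneg (differentiable_id.sub θdiff) fun t => by
      have : HasDerivAt (fun t => t - θ t) (1 - χ t) t := (hasDerivAt_id t).sub (hθ t)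
      rw [this.deriv]
      linarith [χ.le_one (x := t)]
  have hout : ∀ t, rO ≤ |t - (a + b) / 2| → χ t = 0 := fun t ht => χ.zero_of_le_dist ht
  have hright : ∀ t, b ≤ t → θ t = θ b := fun t ht => by
    rw [← sub_eq_zero, hsub]
    refine (intervalIntegral.integral_congr (g := fun _ => 0) fun x hx => hout x ?_).trans
      (by simp)
    rw [Set.uIcc_of_le ht] at hx
    exact le_trans (by rw [hrO]; linarith [hx.1]) (le_abs_self _)
  have hleft : ∀ t, t ≤ a → θ t = θ a := fun t ht => by
    rw [← sub_eq_zero, hsub]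
    refine (intervalIntegral.integral_congr (g := fun _ => 0) fun x hx => hout x ?_).trans
      (by simp)
    rw [Set.uIcc_of_ge ht] at hx
    exact le_trans (by rw [hrO]; linarith [hx.2]) (neg_le_abs _)
  have hmid : θ (b - κ) - θ (a + κ) = b - κ - (a + κ) := by
    rw [hsub]
    refine (intervalIntegral.integral_congr (g := fun _ => 1) fun x hx => χ.one_of_mem_closedBall
      ?_).trans (by simp)
    rw [Set.uIcc_of_le (by linarith)] at hx
    rw [Metric.mem_closedBall, Real.dist_eq, abs_le]
    constructor <;> linarith [hx.1, hx.2]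
  refine ⟨θ, ?_, θ0, fun t => ⟨?_, ?_⟩, fun t => ?_, fun s hs t => ?_⟩
  · exact contDiff_infty_iff_deriv.2 ⟨θdiff, by rw [θd]; exact χs⟩
  -- `θ t ≥ θ a`, as `θ` is constant to the left of `a`, and `θ a ≥ a` by monotonicity of `t - θ t`
  -- and `θ 0 = 0`.
  · have h1 := mono1 (min_le_left t a)
    have h2 := hleft _ (min_le_right t a)
    have h3 := mono2 ha
    simp only [θ0] at h3
    linarith
  · have h1 := mono1 (le_max_left t b)
    have h2 := hright _ (le_max_right t b)
    have h3 := mono2 hb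
    simp only [θ0] at h3
    linarith
  · rw [θd, abs_of_nonneg χ.nonneg]
    exact χ.le_one
  · have h1 : |θ t - θ s| ≤ |t - s| := by
      rcases le_total s t with hst | hst
      · have e1 := mono1 hst
        have e2 := mono2 hst
        simp only at e2
        rw [abs_of_nonneg (by linarith), abs_of_nonneg (by linarith)]
        linarith
      · have e1 := mono1 hst
        have e2 := mono2 hst
        simp only at e2
        rw [abs_of_nonpos (by linarith), abs_of_nonpos (by linarith)]
        linarith
    -- The monotone function `t - θ t` vanishes at `0 ∈ [a, b]` and grows by at most `2 κ ≤ δ`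
    -- across `[a, b]`.
    have h2 : |θ s - s| ≤ δ := by
      have e1 := mono1 (show b - κ ≤ b by linarith)
      have e2 := mono1 (show a ≤ a + κ by linarith)
      have e3 := mono2 hs.1
      have e4 := mono2 hs.2
      have e5 := mono2 ha
      have e6 := mono2 hb
      simp only [θ0] at e3 e4 e5 e6
      rw [abs_le]
      constructor <;> linarith
    calc |θ t - s| = |(θ t - θ s) + (θ s - s)| := by ring_nf
      _ ≤ |θ t - θ s| + |θ s - s| := abs_add_le _ _
      _ ≤ |t - s| + δ := add_le_add h1 h2

/-- Composition of a test function with a smooth function fixing `0`. -/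
noncomputable def compTest (θ : ℝ → ℝ) (hθ : ContDiff ℝ (⊤ : ℕ∞) θ) (h0 : θ 0 = 0)
    (φ : 𝓓(U, ℝ)) : 𝓓(U, ℝ) :=
  ⟨θ ∘ φ, hθ.comp φ.contDiff, φ.hasCompactSupport.comp_left h0,
    (closure_mono (Function.support_comp_subset h0 φ)).trans φ.tsupport_subset⟩

theorem norm_gradient_compTest_le (θ : ℝ → ℝ) (hθ : ContDiff ℝ (⊤ : ℕ∞) θ) (h0 : θ 0 = 0)
    (h1 : ∀ t, |deriv θ t| ≤ 1) (φ : 𝓓(U, ℝ)) (x : EuclideanSpace ℝ (Fin m)) :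
    ‖gradient (compTest θ hθ h0 φ) x‖ ≤ ‖gradient φ x‖ := by
  have hd : DifferentiableAt ℝ θ (φ x) := (hθ.differentiable (by simp)) _
  have e : fderiv ℝ (compTest θ hθ h0 φ) x = deriv θ (φ x) • fderiv ℝ φ x :=
    (hd.hasDerivAt.comp_hasFDerivAt x (differentiable_test φ x).hasFDerivAt).fderiv
  rw [gradient, gradient, LinearIsometryEquiv.norm_map, LinearIsometryEquiv.norm_map, e, norm_smul]
  exact mul_le_of_le_one_left (norm_nonneg _) (h1 _)

theorem integral_norm_gradient_mono {φ ψ : 𝓓(U, ℝ)}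
    (h : ∀ x, ‖gradient φ x‖ ≤ ‖gradient ψ x‖) :
    ∫ x in (U : Set (EuclideanSpace ℝ (Fin m))), ‖gradient φ x‖
      ≤ ∫ x in (U : Set (EuclideanSpace ℝ (Fin m))), ‖gradient ψ x‖ :=
  integral_mono (integrable_grad φ).norm (integrable_grad ψ).norm h

/-- Test functions can be truncated to an interval containing `0`. -/
theorem exists_truncated_test {a b : ℝ} (ha : a ≤ 0) (hb : 0 ≤ b) {f : U → ℝ}
    (hab : ∀ x, f x ∈ Set.Icc a b) {δ : ℝ} (hδ : 0 < δ) (φ : 𝓓(U, ℝ)) :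
    ∃ ψ : 𝓓(U, ℝ), (∀ x, ψ x ∈ Set.Icc a b) ∧ (∀ x : U, |ψ x - f x| ≤ |φ x - f x| + δ) ∧
      ∫ x in (U : Set (EuclideanSpace ℝ (Fin m))), ‖gradient ψ x‖
        ≤ ∫ x in (U : Set (EuclideanSpace ℝ (Fin m))), ‖gradient φ x‖ := by
  obtain ⟨θ, hθ, h0, hI, h1, hd⟩ := exists_smooth_truncation ha hb hδ
  exact ⟨compTest θ hθ h0 φ, fun x => hI _, fun x => hd _ (hab x) _,
    integral_norm_gradient_mono (norm_gradient_compTest_le θ hθ h0 h1 φ)⟩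

/-! ### The case of vanishing seminorm -/

/-- A Poincaré type inequality with a weight that is integrable in one direction. -/
theorem integral_sq_div_le (i : Fin m) (φ : 𝓓(U, ℝ)) {M : ℝ} (hM : ∀ x, |φ x| ≤ M) :
    ∫ x, φ x ^ 2 / (1 + x i ^ 2)
      ≤ Real.pi * M * ∫ x in (U : Set (EuclideanSpace ℝ (Fin m))), ‖gradient φ x‖ := by
  set v : EuclideanSpace ℝ (Fin m) := EuclideanSpace.single i 1 with hv
  have hφd : ∀ x, HasFDerivAt φ (fderiv ℝ φ x) x := fun x => (differentiable_test φ x).hasFDerivAt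
  -- The arctangent of the `i`-th coordinate is bounded by `π / 2` and has derivative `1 / (1 +
  -- xᵢ²)` in direction `i`. Integrating by parts against `φ²` moves the derivative to `2 φ ∂ᵢφ`,
  -- bounded by `2 M ‖∇φ‖`.
  let A : EuclideanSpace ℝ (Fin m) → ℝ := fun x => Real.arctan (x i)
  have hA : ∀ x, HasFDerivAt A ((1 / (1 + x i ^ 2)) •
      (EuclideanSpace.proj i : EuclideanSpace ℝ (Fin m) →L[ℝ] ℝ)) x := fun x =>
    (Real.hasDerivAt_arctan (x i)).comp_hasFDerivAt
      (f := fun y : EuclideanSpace ℝ (Fin m) => y i) x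
      (EuclideanSpace.proj i : EuclideanSpace ℝ (Fin m) →L[ℝ] ℝ).hasFDerivAt
  have hAv : ∀ x, fderiv ℝ A x v = 1 / (1 + x i ^ 2) := fun x => by
    rw [(hA x).fderiv]
    simp [hv]
  have hφv : ∀ x, fderiv ℝ (fun x => φ x ^ 2) x v = 2 * φ x * inner ℝ (gradient φ x) v :=
    fun x => by
      rw [((hφd x).pow 2).fderiv, inner_gradient_left]
      simp
  have hci : Continuous fun x : EuclideanSpace ℝ (Fin m) => x i :=
    (EuclideanSpace.proj i : EuclideanSpace ℝ (Fin m) →L[ℝ] ℝ).continuous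
  have hcA : Continuous A := Real.continuous_arctan.comp hci
  have hcs : HasCompactSupport fun x => φ x ^ 2 :=
    φ.hasCompactSupport.comp_left (g := fun t : ℝ => t ^ 2) (by simp)
  have hcg := continuous_gradient_test φ
  have hsg := hasCompactSupport_gradient_test φ
  have hcin : Continuous fun x => 2 * φ x * inner ℝ (gradient φ x) v :=
    (continuous_const.mul φ.continuous).mul (hcg.inner continuous_const)
  have hsin : HasCompactSupport fun x => 2 * φ x * inner ℝ (gradient φ x) v :=
    HasCompactSupport.mul_left (hsg.comp_left (g := fun w => inner ℝ w v) (inner_zero_left v))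
  have hcden : Continuous fun x : EuclideanSpace ℝ (Fin m) => 1 / (1 + x i ^ 2) :=
    continuous_const.div (continuous_const.add (hci.pow 2)) fun x => by positivity
  have key := integral_mul_fderiv_eq_neg_fderiv_mul_of_integrable
    (μ := (volume : Measure (EuclideanSpace ℝ (Fin m)))) (f := A) (g := fun x => φ x ^ 2) (v := v)
    (by
      simp only [hAv]
      exact (hcden.mul (φ.continuous.pow 2)).integrable_of_hasCompactSupport hcs.mul_left)
    (by
      simp only [hφv]
      exact (hcA.mul hcin).integrable_of_hasCompactSupport hsin.mul_left)
    ((hcA.mul (φ.continuous.pow 2)).integrable_of_hasCompactSupport hcs.mul_left)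
    (fun x _ => (hA x).differentiableAt) (fun x _ => ((hφd x).pow 2).differentiableAt)
  simp only [hAv, hφv] at key
  have e1 : ∫ x, φ x ^ 2 / (1 + x i ^ 2) = ∫ x, 1 / (1 + x i ^ 2) * φ x ^ 2 :=
    integral_congr_ae (Eventually.of_forall fun x => by simp only; ring)
  have e2 : ∫ x in (U : Set (EuclideanSpace ℝ (Fin m))), ‖gradient φ x‖ = ∫ x, ‖gradient φ x‖ := by
    refine setIntegral_eq_integral_of_forall_compl_eq_zero fun x hx => ?_
    have : x ∉ tsupport φ := fun h => hx (φ.tsupport_subset h)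
    rw [gradient, fderiv_of_notMem_tsupport ℝ this, map_zero, norm_zero]
  rw [e1, e2, ← integral_const_mul]
  calc ∫ x, 1 / (1 + x i ^ 2) * φ x ^ 2
      = ∫ x, -(A x * (2 * φ x * inner ℝ (gradient φ x) v)) := by
        rw [integral_neg, key, neg_neg]
    _ ≤ ∫ x, Real.pi * M * ‖gradient φ x‖ := by
        refine integral_mono ((hcA.mul hcin).integrable_of_hasCompactSupport hsin.mul_left).neg
          ((hcg.integrable_of_hasCompactSupport hsg).norm.const_mul _) fun x => ?_
        have b1 : |A x| ≤ Real.pi / 2 :=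
          abs_le.2 ⟨(Real.neg_pi_div_two_lt_arctan _).le, (Real.arctan_lt_pi_div_two _).le⟩
        have b2 : |inner ℝ (gradient φ x) v| ≤ ‖gradient φ x‖ :=
          (abs_real_inner_le_norm _ _).trans_eq (by simp [hv])
        have hpi := Real.pi_pos
        have hM0 : 0 ≤ M := (abs_nonneg _).trans (hM x)
        calc -(A x * (2 * φ x * inner ℝ (gradient φ x) v))
            ≤ |A x * (2 * φ x * inner ℝ (gradient φ x) v)| := neg_le_abs _
          _ = |A x| * (2 * |φ x| * |inner ℝ (gradient φ x) v|) := by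
              simp only [abs_mul, abs_two]
          _ ≤ Real.pi / 2 * (2 * M * ‖gradient φ x‖) := by
              gcongr
              exact hM x
          _ = Real.pi * M * ‖gradient φ x‖ := by ring

/-- A continuous function whose fluctuation seminorm vanishes is zero. -/
theorem eq_zero_of_bfNorm_eq_zero (hm : 1 ≤ m) {f : U → ℝ} (hf : HasBoundedFluctuation U f)
    (hc : Continuous f) (h0 : (bfNorm U f).toReal = 0) (x₀ : U) : f x₀ = 0 := by
  by_contra hne
  obtain ⟨M', hM'⟩ := hf.bounded
  set M := max M' 0 with hMdef
  have hM0 : 0 ≤ M := le_max_right _ _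
  have hM : ∀ x, f x ∈ Set.Icc (-M) M := fun x => abs_le.1 ((hM' x).trans (le_max_left _ _))
  let i : Fin m := ⟨0, hm⟩
  set d := |f x₀| with hd
  have d0 : 0 < d := abs_pos.2 hne
  have hn : {x | d / 2 < |f x|} ∈ 𝓝 x₀ :=
    (isOpen_lt continuous_const hc.abs).mem_nhds (by change d / 2 < |f x₀|; linarith)
  have : LocallyCompactSpace U := U.isOpen.locallyCompactSpace
  obtain ⟨K, hKn, hKs, hK⟩ := local_compact_nhds hn
  set K' : Set (EuclideanSpace ℝ (Fin m)) := Subtype.val '' K with hK'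
  have hK'c : IsCompact K' := hK.image continuous_subtype_val
  have hK'n : K' ∈ 𝓝 (x₀ : EuclideanSpace ℝ (Fin m)) :=
    U.isOpen.isOpenEmbedding_subtypeVal.image_mem_nhds.2 hKn
  have hci : Continuous fun x : EuclideanSpace ℝ (Fin m) => x i :=
    (EuclideanSpace.proj i : EuclideanSpace ℝ (Fin m) →L[ℝ] ℝ).continuous
  have hden : Continuous fun x : EuclideanSpace ℝ (Fin m) => 1 + x i ^ 2 :=
    continuous_const.add (hci.pow 2)
  have hdpos : ∀ x : EuclideanSpace ℝ (Fin m), 0 < 1 + x i ^ 2 := fun x => by positivity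
  set c := ∫ x in K', (d / 4) ^ 2 / (1 + x i ^ 2) with hcdef
  have hint : IntegrableOn (fun x => (d / 4) ^ 2 / (1 + x i ^ 2)) K' :=
    (continuous_const.div hden fun x => (hdpos x).ne').continuousOn.integrableOn_compact hK'c
  have hpos : ∀ x : EuclideanSpace ℝ (Fin m), 0 < (d / 4) ^ 2 / (1 + x i ^ 2) := fun x =>
    div_pos (by positivity) (hdpos x)
  have c0 : 0 < c := by
    rw [hcdef, integral_pos_iff_support_of_nonneg (fun x => (hpos x).le) hint]
    have : (Function.support fun x : EuclideanSpace ℝ (Fin m) => (d / 4) ^ 2 / (1 + x i ^ 2))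
        = Set.univ := Set.eq_univ_of_forall fun x => (hpos x).ne'
    rw [this, Measure.restrict_apply_univ]
    exact Measure.measure_pos_of_mem_nhds _ hK'n
  have hpM : 0 < Real.pi * M + 1 := by positivity
  -- As the seminorm is zero, the gradient bound may be any positive number. This choice makes the
  -- right side of the Poincaré type inequality at most `c / 2`, while its left side will be at
  -- least `c`.
  have hη : (bfNorm U f).toReal < c / 2 / (Real.pi * M + 1) := by rw [h0]; positivity
  obtain ⟨φ₀, hφ₀, hφ₀R⟩ := exists_test_approx hf hc hK (ε := d / 8) (by linarith) hη
  obtain ⟨φ, hφM, hφf, hφR⟩ := exists_truncated_test (neg_nonpos.2 hM0) hM0 hM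
    (δ := d / 8) (by linarith) φ₀
  have h1 := integral_sq_div_le i φ (M := M) fun x => abs_le.2 (hφM x)
  have hI : Integrable fun x => φ x ^ 2 / (1 + x i ^ 2) := by
    refine ((φ.continuous.pow 2).div hden fun x => (hdpos x).ne').integrable_of_hasCompactSupport ?_
    simp only [div_eq_mul_inv]
    have hcs : HasCompactSupport fun x => φ x ^ 2 :=
      φ.hasCompactSupport.comp_left (g := fun t : ℝ => t ^ 2) (by simp)
    exact hcs.mul_right
  have h2 : c ≤ ∫ x in K', φ x ^ 2 / (1 + x i ^ 2) := by
    refine setIntegral_mono_on hint hI.integrableOn hK'c.measurableSet ?_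
    rintro _ ⟨x, hx, rfl⟩
    have e1 := hφ₀ x hx
    have e2 := hφf x
    have e3 : d / 2 < |f x| := hKs hx
    have e4 : |f x| ≤ |φ x| + |φ x - f x| := by
      have := abs_sub_abs_le_abs_sub (f x) (φ x)
      rw [abs_sub_comm] at this
      linarith
    have e5 : d / 4 ≤ |φ x| := by linarith
    have e6 : (d / 4) ^ 2 ≤ φ x ^ 2 := by
      rw [← sq_abs (φ x)]
      exact pow_le_pow_left₀ (by linarith) e5 2
    exact div_le_div_of_nonneg_right e6 (hdpos _).le
  have h3 : ∫ x in K', φ x ^ 2 / (1 + x i ^ 2) ≤ ∫ x, φ x ^ 2 / (1 + x i ^ 2) :=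
    setIntegral_le_integral hI (Eventually.of_forall fun x =>
      div_nonneg (sq_nonneg _) (hdpos x).le)
  have h4 := hφR.trans hφ₀R
  have h5 : Real.pi * M * ∫ x in (U : Set (EuclideanSpace ℝ (Fin m))), ‖gradient φ x‖
      ≤ (Real.pi * M + 1) * (c / 2 / (Real.pi * M + 1)) := by
    gcongr
    · linarith
  rw [mul_div_cancel₀ _ hpM.ne'] at h5
  linarith

/-- Approximation by truncated test functions that respect the bound given by the seminorm. -/
theorem exists_truncated_test_approx (hm : 1 ≤ m) {a b : ℝ} (ha : a ≤ 0) (hb : 0 ≤ b) {f : U → ℝ}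
    (hf : HasBoundedFluctuation U f) (hc : Continuous f) (hab : ∀ x, f x ∈ Set.Icc a b)
    {K : Set U} (hK : IsCompact K) {ε : ℝ} (hε : 0 < ε) :
    ∃ φ : 𝓓(U, ℝ), (∀ x, φ x ∈ Set.Icc a b) ∧ (∀ x ∈ K, |φ x - f x| ≤ ε) ∧
      ∫ x in (U : Set (EuclideanSpace ℝ (Fin m))), ‖gradient φ x‖ ≤ (bfNorm U f).toReal := by
  set R := (bfNorm U f).toReal with hRdef
  rcases eq_or_lt_of_le (ENNReal.toReal_nonneg : 0 ≤ (bfNorm U f).toReal) with hR | hR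
  · refine ⟨0, fun x => ⟨ha, hb⟩, fun x _ => ?_, ?_⟩
    · rw [eq_zero_of_bfNorm_eq_zero hm hf hc hR.symm x, sub_zero, FunLike.coe_zero, Pi.zero_apply,
        abs_zero]
      exact hε.le
    · have : ∀ x, gradient (0 : 𝓓(U, ℝ)) x = 0 := fun x => by
        have := gradient_test_smul (0 : ℝ) (0 : 𝓓(U, ℝ)) x
        rwa [zero_smul, zero_smul] at this
      simp only [this, norm_zero, integral_zero]
      exact hR.le
  · obtain ⟨M, hM⟩ := hf.bounded
    set η := ε / (3 * (|M| + 1)) with hη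
    have η0 : 0 < η := by positivity
    have hs0 : 0 < 1 + η := by linarith
    have hηM : η * |M| ≤ ε / 3 := by
      rw [hη, div_mul_eq_mul_div, div_le_iff₀ (by positivity)]
      nlinarith
    obtain ⟨φ₀, h1, h2⟩ := exists_test_approx hf hc hK (ε := ε / 3) (R := (1 + η) * R)
      (by linarith) (by rw [← hRdef] at hR ⊢; nlinarith)
    obtain ⟨φ, hφI, hφf, hφR⟩ := exists_truncated_test ha hb hab (δ := ε / 3) (by linarith)
      ((1 + η)⁻¹ • φ₀)
    refine ⟨φ, hφI, fun x hx => (hφf x).trans ?_, hφR.trans ?_⟩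
    · have e : ((1 + η)⁻¹ • φ₀ : 𝓓(U, ℝ)) x - f x
          = (1 + η)⁻¹ * ((φ₀ x - f x) - η * f x) := by
        rw [FunLike.coe_smul, Pi.smul_apply, smul_eq_mul]
        field_simp
        ring
      have e2 : |(φ₀ x - f x) - η * f x| ≤ ε / 3 + ε / 3 := by
        refine (abs_sub _ _).trans (add_le_add (h1 x hx) ?_)
        rw [abs_mul, abs_of_pos η0]
        exact (mul_le_mul_of_nonneg_left ((hM x).trans (le_abs_self M)) η0.le).trans hηM
      rw [e, abs_mul, abs_of_pos (inv_pos.2 hs0)]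
      have e3 := mul_le_mul_of_nonneg_right (inv_le_one_of_one_le₀ (by linarith : 1 ≤ 1 + η))
        (abs_nonneg ((φ₀ x - f x) - η * f x))
      linarith
    · simp only [gradient_test_smul, norm_smul, norm_inv, Real.norm_of_nonneg hs0.le,
        integral_const_mul]
      rwa [inv_mul_le_iff₀ hs0]

theorem abs_gradPairing_le (φ : 𝓓(U, ℝ)) (u : LInf U) :
    |gradPairing φ u|
      ≤ (∫ x in (U : Set (EuclideanSpace ℝ (Fin m))), ‖gradient φ x‖) * ‖u‖ := by
  rw [gradPairing, ← integral_mul_const, ← Real.norm_eq_abs]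
  refine norm_integral_le_of_norm_le ((integrable_grad φ).norm.mul_const _) ?_
  filter_upwards [ae_le_eLpNormEssSup (f := u)
    (μ := volume.restrict (U : Set (EuclideanSpace ℝ (Fin m))))] with x hx
  have h1 : ‖u x‖ ≤ ‖u‖ := by
    rw [Lp.norm_def, eLpNorm_exponent_top, ← toReal_enorm]
    refine ENNReal.toReal_mono ?_ hx
    rw [← eLpNorm_exponent_top]
    exact Lp.eLpNorm_ne_top u
  exact (norm_inner_le_norm (𝕜 := ℝ) _ _).trans (mul_le_mul_of_nonneg_left h1 (norm_nonneg _))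

/-- Bounded pointwise convergence implies convergence of the integrals against a signed measure. -/
theorem tendsto_sIntegral {F : ℕ → U → ℝ} {f : U → ℝ} (hF : ∀ n, Continuous (F n))
    (hf : Continuous f) {C : ℝ} (hFC : ∀ n x, |F n x| ≤ C) (hfC : ∀ x, |f x| ≤ C)
    (h : ∀ x, Tendsto (fun n => F n x) atTop (𝓝 (f x))) (μ : SignedMeasure U) :
    Tendsto (fun n => sIntegral (F n) μ) atTop (𝓝 (sIntegral f μ)) := by
  simp only [fun n => sIntegral_eq μ (hF n) ⟨C, hFC n⟩, sIntegral_eq μ hf ⟨C, hfC⟩]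
  have key : ∀ P : Measure U, IsFiniteMeasure P →
      Tendsto (fun n => ∫ x, F n x ∂P) atTop (𝓝 (∫ x, f x ∂P)) := fun P _ =>
    tendsto_integral_of_dominated_convergence (fun _ => C)
      (fun n => (hF n).aestronglyMeasurable) (integrable_const C)
      (fun n => Eventually.of_forall (hFC n)) (Eventually.of_forall h)
  exact (key _ inferInstance).sub (key _ inferInstance)

/-- For test functions with gradients bounded in `L₁` that converge boundedly and pointwise to `f`,
the gradients converge weakly* to the functional of `f`. -/
theorem tendsto_gradPairing {f : U → ℝ} (hf : HasBoundedFluctuation U f) (hc : Continuous f)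
    {φ : ℕ → 𝓓(U, ℝ)} {C R : ℝ} (hφC : ∀ n (x : U), |φ n x| ≤ C) (hfC : ∀ x, |f x| ≤ C)
    (hφR : ∀ n, ∫ x in (U : Set (EuclideanSpace ℝ (Fin m))), ‖gradient (φ n) x‖ ≤ R)
    (h : ∀ x : U, Tendsto (fun n => φ n x) atTop (𝓝 (f x))) (u : DB U) :
    Tendsto (fun n => gradPairing (φ n) (u : LInf U)) atTop
      (𝓝 (fluctuationFunctional f u)) := by
  set L := fluctuationFunctional f with hL
  have hDM : ∀ v : DM U, Tendsto (fun n => gradPairing (φ n) (v : LInf U)) atTop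
      (𝓝 (L (DM.toDB v))) := fun v => by
    rw [isFluctuationFunctional hf hc v]
    simp only [isDivergence_divMeasure v _]
    exact (tendsto_sIntegral (fun n => continuous_test (φ n)) hc hφC hfC h _).neg
  have hR : 0 ≤ R := (integral_nonneg fun x => norm_nonneg _).trans (hφR 0)
  rw [Metric.tendsto_atTop]
  intro ε hε
  have hden : 0 < R + ‖L‖ + 1 := by positivity
  obtain ⟨v, hv⟩ := (denseRange_toDB (U := U)).exists_dist_lt u
    (show 0 < ε / 2 / (R + ‖L‖ + 1) by positivity)
  obtain ⟨n₀, hn₀⟩ := (Metric.tendsto_atTop.1 (hDM v)) (ε / 2) (by positivity)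
  refine ⟨n₀, fun n hn => ?_⟩
  have h1 := hn₀ n hn
  have h2 : gradPairing (φ n) (u : LInf U) = gradPairing (φ n) (v : LInf U)
      + gradPairing (φ n) (u - DM.toDB v : DB U) := by
    rw [← gradPairing_add]
    congr 1
    rw [Submodule.coe_sub]
    exact (add_sub_cancel (v : LInf U) u).symm
  have h3 : L u = L (DM.toDB v) + L (u - DM.toDB v) := by rw [← map_add, add_sub_cancel]
  have h4 := (abs_gradPairing_le (φ n) (u - DM.toDB v : DB U)).trans
    (mul_le_mul_of_nonneg_right (hφR n) (norm_nonneg _))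
  have h5 := L.le_opNorm (u - DM.toDB v)
  rw [dist_eq_norm, lt_div_iff₀ hden] at hv
  have h6 : ‖((u - DM.toDB v : DB U) : LInf U)‖ = ‖u - DM.toDB v‖ := rfl
  rw [h6] at h4
  rw [Real.norm_eq_abs] at h5
  rw [Real.dist_eq] at h1 ⊢
  rw [h2, h3]
  have h7 := norm_nonneg (u - DM.toDB v)
  calc |gradPairing (φ n) (v : LInf U) + gradPairing (φ n) (u - DM.toDB v : DB U)
        - (L (DM.toDB v) + L (u - DM.toDB v))|
      = |(gradPairing (φ n) (v : LInf U) - L (DM.toDB v))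
        + (gradPairing (φ n) (u - DM.toDB v : DB U) - L (u - DM.toDB v))| := by ring_nf
    _ ≤ |gradPairing (φ n) (v : LInf U) - L (DM.toDB v)|
        + (|gradPairing (φ n) (u - DM.toDB v : DB U)| + |L (u - DM.toDB v)|) :=
        (abs_add_le _ _).trans (add_le_add le_rfl (abs_sub _ _))
    _ < ε := by linarith

theorem eLpNorm_gradient_eq (φ : 𝓓(U, ℝ)) :
    eLpNorm (gradient φ) 1 (volume.restrict (U : Set (EuclideanSpace ℝ (Fin m))))
      = ENNReal.ofReal (∫ x in (U : Set (EuclideanSpace ℝ (Fin m))), ‖gradient φ x‖) := by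
  rw [eLpNorm_one_eq_lintegral_enorm, ofReal_integral_norm_eq_lintegral_enorm (integrable_grad φ)]

end BoundedFluctuation

theorem mainTheorem10 {m : ℕ} (hm : 1 ≤ m) (U : Opens (EuclideanSpace ℝ (Fin m)))
    (a b : ℝ) (ha : a ≤ 0) (hb : 0 ≤ b) (f : U → ℝ) (hf : HasBoundedFluctuation U f)
    (hcont : Continuous f) (hab : ∀ x, f x ∈ Set.Icc a b) :
    ∃ φ : ℕ → 𝓓(U, ℝ),
      (∀ n x, x ∈ U → φ n x ∈ Set.Icc a b) ∧
      (∀ n, eLpNorm (gradient (φ n)) 1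
        (volume.restrict (U : Set (EuclideanSpace ℝ (Fin m)))) ≤ bfNorm U f) ∧
      (∀ K : Set U, IsCompact K → TendstoUniformlyOn (fun n (x : U) => φ n x) f atTop K) ∧
      (∀ u : DB U, Tendsto (fun n => gradPairing (φ n) (u : LInf U)) atTop
        (𝓝 (fluctuationFunctional f u))) := by
  have : LocallyCompactSpace U := U.isOpen.locallyCompactSpace
  let E : CompactExhaustion U := default
  choose φ hφI hφf hφR using fun n : ℕ => exists_truncated_test_approx hm ha hb hf hcont hab
    (E.isCompact n) (Nat.one_div_pos_of_nat (α := ℝ) (n := n))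
  have hunif : ∀ K : Set U, IsCompact K →
      TendstoUniformlyOn (fun n (x : U) => φ n x) f atTop K := fun K hK => by
    obtain ⟨n₀, hn₀⟩ := E.exists_superset_of_isCompact hK
    rw [Metric.tendstoUniformlyOn_iff]
    intro ε hε
    filter_upwards [eventually_ge_atTop n₀,
      tendsto_one_div_add_atTop_nhds_zero_nat.eventually_lt_const hε] with n hn hnε x hx
    rw [dist_comm, Real.dist_eq]
    exact (hφf n x (E.subset hn (hn₀ hx))).trans_lt hnε
  have hC : ∀ t ∈ Set.Icc a b, |t| ≤ max (-a) b := fun t ht => abs_le.2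
    ⟨by linarith [ht.1, le_max_left (-a) b], ht.2.trans (le_max_right _ _)⟩
  refine ⟨φ, fun n x _ => hφI n x, fun n => ?_, hunif, fun u => ?_⟩
  · rw [eLpNorm_gradient_eq, ENNReal.ofReal_le_iff_le_toReal hf.finite.ne]
    exact hφR n
  · exact tendsto_gradPairing hf hcont (fun n x => hC _ (hφI n x)) (fun x => hC _ (hab x)) hφR
      (fun x => (hunif {x} isCompact_singleton).tendsto_at rfl) u
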